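/- Let $G$ be a finite graph (parallel edges allowed) drawn in the plane: vertices are distinct points; each edge is a homeomorphic image of $[0,1]$ that joins the points of its two ends and has no vertex in its interior. A \emph{crossing} of two distinct edges is a point interior to both; no third edge passes through it, and the two edges cross transversally there. (Two edges may cross repeatedly, and edges with a common end may cross.) Suppose the drawing is \emph{$k$-plane}, i.e. every edge is crossed at most $k$ times. The planarization $G^\times$ has as vertices the vertices of $G$ and the crossings; for an edge $g$, the vertices of its planarization $g^\times$ are its two ends and the crossings on it. The faces are the connected components of the complement of the drawing. The radial graph is the bipartite graph in which a vertex of $G^\times$ is adjacent to each face whose boundary contains it, and the face-distance $d_F(u,v)$ of two vertices of $G^\times$ is the number of faces on a shortest path between them in the radial graph. Let $\mathcal B(c,r)$ be the set of vertices of $G^\times$ at face-distance at most $r$ from $c$. For a crossing $c$ of edges $e,e'$, a pair consisting of an end of $e$ and an end of $e'$ is a pair of \emph{consecutive endpoints} of $c$. The \emph{ribbon radius} $\mu(c)$ is the smallest $r$ such that $\mathcal B(c,r)$ contains all vertices of $e^\times$ and of $e'^\times$ and, for some path of $G$ (possibly of length $0$) that connects two consecutive endpoints of $c$, all vertices of the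 planarizations of the edges of that path ($\mu(c)=\infty$ if there is no such $r$). The crossing $c$ is an \emph{$\times$-crossing} if $e$ and $e'$ are the only edges of $G$ that join two consecutive endpoints of $c$. \textbf{Claim.} If a crossing $c$ of edges $e,e'$ is not an $\times$-crossing, then $$\mu(c)\le\left\lfloor\frac{3k+1}{2}\right\rfloor .$$ Moreover, for every edge $\hat e\notin\{e,e'\}$ that joins two consecutive endpoints of $c$, all vertices of $e^\times$, $\hat e^\times$ and $e'^\times$ lie in $\mathcal B\bigl(c,\lfloor\frac{3k+1}{2}\rfloor\bigr)$. -/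

import Mathlib

open Set
open scoped Graph

/-- Walks in a multigraph `G` from `x` to `y`, recorded with the edges that are used. -/
inductive GraphWalk {α β : Type*} (G : Graph α β) : α → α → Type _
  | nil {x : α} (hx : x ∈ V(G)) : GraphWalk G x x
  | cons {x y z : α} (e : β) (h : G.IsLink e x y) (p : GraphWalk G y z) : GraphWalk G x z

namespace GraphWalk

variable {α β : Type*} {G : Graph α β}

/-- The vertices visited by a walk, in order. -/
def support : {x y : α} → GraphWalk G x y → List α
  | x, _, .nil _ => [x]
  | x, _, .cons _ _ p => x :: p.support

/-- The edges traversed by a walk, in order. -/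
def edges : {x y : α} → GraphWalk G x y → List β
  | _, _, .nil _ => []
  | _, _, .cons e _ p => e :: p.edges

/-- A path is a walk that visits every vertex at most once. -/
def IsPath {x y : α} (p : GraphWalk G x y) : Prop := p.support.Nodup

end GraphWalk

/-- A drawing of the multigraph `G` in the plane `ℂ = ℝ²`. Vertices are mapped to distinct points,
edges to homeomorphic images of `[0,1]` (injective continuous curves; `[0,1]` is compact) that join
the points of their ends and have no vertex in their interior. At most two edges pass through a
point that is interior to edges, and two edges that have a common interior point cross
transversally there. Two edges may cross repeatedly, and edges with a common end may cross. -/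
structure PlaneDrawing {α β : Type*} (G : Graph α β) where
  /-- The point that represents a vertex. -/
  point : α → ℂ
  /-- The curve that represents an edge, parametrized by `[0,1]`. -/
  curve : β → ℝ → ℂ
  point_injOn : InjOn point V(G)
  curve_continuousOn : ∀ e ∈ E(G), ContinuousOn (curve e) (Icc 0 1)
  curve_injOn : ∀ e ∈ E(G), InjOn (curve e) (Icc 0 1)
  curve_ends : ∀ e ∈ E(G), ∃ x y, G.IsLink e x y ∧ curve e 0 = point x ∧ curve e 1 = point y
  curve_ne_point : ∀ e ∈ E(G), ∀ t ∈ Ioo (0 : ℝ) 1, ∀ x ∈ V(G), curve e t ≠ point x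
  no_third_edge : ∀ e ∈ E(G), ∀ f ∈ E(G), ∀ g ∈ E(G), ∀ z : ℂ,
    z ∈ curve e '' Ioo 0 1 → z ∈ curve f '' Ioo 0 1 → z ∈ curve g '' Ioo 0 1 →
      e = f ∨ e = g ∨ f = g
  /-- Near a crossing `z`, some homeomorphism between neighbourhoods of `z` and of `0` turns the
  two curves into the two coordinate axes. -/
  transversal : ∀ e ∈ E(G), ∀ f ∈ E(G), e ≠ f → ∀ z : ℂ,
    z ∈ curve e '' Ioo 0 1 → z ∈ curve f '' Ioo 0 1 →
      ∃ φ : OpenPartialHomeomorph ℂ ℂ, z ∈ φ.source ∧ φ z = 0 ∧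
        ∀ w ∈ φ.source, (w ∈ curve e '' Ioo 0 1 ↔ (φ w).im = 0) ∧
          (w ∈ curve f '' Ioo 0 1 ↔ (φ w).re = 0)

namespace PlaneDrawing

variable {α β : Type*} {G : Graph α β} (D : PlaneDrawing G)

/-- The distinct edges `e` and `f` cross at the point `z`. -/
def CrossAt (e f : β) (z : ℂ) : Prop :=
  e ∈ E(G) ∧ f ∈ E(G) ∧ e ≠ f ∧ z ∈ D.curve e '' Ioo 0 1 ∧ z ∈ D.curve f '' Ioo 0 1

/-- The drawing is `k`-plane: every edge is crossed at most `k` times. -/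
def IsKPlane (k : ℕ) : Prop :=
  ∀ e ∈ E(G), {z : ℂ | ∃ f, D.CrossAt e f z}.encard ≤ k

/-- The vertices of the planarization: the points of the vertices of `G` and the crossing points. -/
def planarVertexSet : Set ℂ := D.point '' V(G) ∪ {z | ∃ e f, D.CrossAt e f z}

/-- The type of vertices of the planarization. -/
abbrev PVertex : Type := D.planarVertexSet

/-- The part of the plane covered by the drawing. -/
def carrier : Set ℂ := D.point '' V(G) ∪ ⋃ e ∈ E(G), D.curve e '' Icc 0 1

/-- The faces: the maximal connected regions of the complement of the drawing. -/
def faceSet : Set (Set ℂ) := {F | ∃ z ∈ D.carrierᶜ, F = connectedComponentIn D.carrierᶜ z}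

/-- The radial graph: the bipartite graph on the vertices of the planarization and the faces, with
an edge whenever the vertex lies on the boundary of the face. -/
def radialGraph : SimpleGraph (D.PVertex ⊕ D.faceSet) where
  Adj
    | .inl v, .inr F => (v : ℂ) ∈ frontier (F : Set ℂ)
    | .inr F, .inl v => (v : ℂ) ∈ frontier (F : Set ℂ)
    | _, _ => False
  symm := ⟨by rintro (v | F) (w | F') h <;> exact h⟩
  loopless := ⟨by rintro (v | F) h <;> exact h⟩

/-- The face-distance: the least number of faces on a walk of the radial graph from `u` to `v`.
A walk between two vertices of the planarization alternates between vertices and faces, so this is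
the number of faces on a shortest path. -/
noncomputable def faceDist (u v : D.PVertex) : ℕ∞ :=
  ⨅ p : D.radialGraph.Walk (.inl u) (.inl v), (p.support.countP Sum.isRight : ℕ∞)

/-- The vertices of the ball of face-radius `r` around `c`. -/
def ball (c : D.PVertex) (r : ℕ) : Set D.PVertex := {v | D.faceDist c v ≤ r}

/-- The vertices of the planarization of the edge `e`: its ends and the crossings on it. -/
def edgeVertices (e : β) : Set D.PVertex := {v | (v : ℂ) ∈ D.curve e '' Icc 0 1}

/-- The vertex `c` of the planarization is a crossing. -/
def IsCrossing (c : D.PVertex) : Prop := ∃ e f, D.CrossAt e f c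

/-- The edge `g` joins two consecutive endpoints of a crossing of `e` and `f`, that is, an end
of `e` and an end of `f`. -/
def JoinsConsecutive (_D : PlaneDrawing G) (e f g : β) : Prop :=
  ∃ a b, G.Inc e a ∧ G.Inc f b ∧ G.IsLink g a b

/-- `c` is an `×`-crossing: the crossing edges are the only edges between consecutive endpoints. -/
def IsXCrossing (c : D.PVertex) : Prop :=
  D.IsCrossing c ∧
    ∀ e f, D.CrossAt e f c → ∀ g, D.JoinsConsecutive e f g → g = e ∨ g = f

/-- The set `B` contains a planarized ribbon of the crossing `c`: it contains the planarizations of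
the two edges that cross at `c`, and of all edges of some path of `G` that connects two
consecutive endpoints of `c`. -/
def ContainsRibbon (c : D.PVertex) (B : Set D.PVertex) : Prop :=
  ∃ e f, D.CrossAt e f c ∧ D.edgeVertices e ⊆ B ∧ D.edgeVertices f ⊆ B ∧
    ∃ a b, G.Inc e a ∧ G.Inc f b ∧
      ∃ p : GraphWalk G a b, p.IsPath ∧ ∀ g ∈ p.edges, D.edgeVertices g ⊆ B

/-- The ribbon radius `μ(c)` of a crossing `c`: the radius of a smallest ball centered at `c`
that contains a planarized ribbon of `c` (and `⊤` if no ball does). -/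
noncomputable def ribbonRadius (c : D.PVertex) : ℕ∞ :=
  ⨅ (r : ℕ) (_ : D.ContainsRibbon c (D.ball c r)), (r : ℕ∞)

end PlaneDrawing

/-! Consecutive vertices on an edge lie on the boundary of a common face, so moving along an edge
costs at most one face per segment (`faceDist_le_one_of_consecutive`, `faceDist_le_of_encard_le`).
From `c` to a vertex of a crossing edge one passes at most `k - 1` further crossings and an end, so
the distance is at most `k`. A third edge between consecutive endpoints has at most `k + 1`
segments; each of its vertices is at most `⌊(k+1)/2⌋` segments from one of its ends, and `k +
⌊(k+1)/2⌋ = ⌊(3k+1)/2⌋`. That edge alone serves as the path of the ribbon.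

The topological content is `exists_component_arc_subset_closure`: one face borders a segment along
its whole length. If the closure of the face missed an interior point of the segment, cut out a
small subarc there. The two remaining stubs, attached one after the other, each meet the rest in a
single point and hence separate nothing, so the face would extend through the gap. That such stubs
do not separate follows from Eilenberg's criterion: `x` and `y` lie in one component of the
complement of a compact `K` iff `(z - x) / (z - y)` has a continuous logarithm on `K`. Logarithms on
two closed sets that share one point can be glued after adding a constant. -/

open Filter Topology Metric

/-! ### Eilenberg's separation criterion. -/

/-- The function `(z - x) / (z - y)` has a continuous logarithm on `K`. -/
def HasRatioLog (K : Set ℂ) (x y : ℂ) : Prop :=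
  ∃ L : ℂ → ℂ, ContinuousOn L K ∧ ∀ z ∈ K, Complex.exp (L z) * (z - y) = z - x

theorem HasRatioLog.symm {K : Set ℂ} {x y : ℂ} (h : HasRatioLog K x y) : HasRatioLog K y x := by
  obtain ⟨L, hL, hLe⟩ := h
  refine ⟨fun z => -L z, hL.neg, fun z hz => ?_⟩
  rw [← hLe z hz, ← mul_assoc, ← Complex.exp_add]
  simp

theorem HasRatioLog.trans {K : Set ℂ} {x y w : ℂ} (h : HasRatioLog K x y)
    (h' : HasRatioLog K y w) : HasRatioLog K x w := by
  obtain ⟨L, hL, hLe⟩ := h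
  obtain ⟨M, hM, hMe⟩ := h'
  refine ⟨fun z => L z + M z, hL.add hM, fun z hz => ?_⟩
  rw [← hLe z hz, ← hMe z hz, Complex.exp_add, mul_assoc]

/-- Two points in a connected set disjoint from the compact set `K` satisfy the logarithm criterion. -/
theorem HasRatioLog.of_isPreconnected {K S : Set ℂ} (hK : IsCompact K) (hS : IsPreconnected S)
    (hSK : Disjoint S K) {x y : ℂ} (hx : x ∈ S) (hy : y ∈ S) : HasRatioLog K x y := by
  -- The criterion is symmetric and transitive, so on a connected set it only has to be checked for
  -- nearby points.
  refine hS.induction₂ (HasRatioLog K) (fun a ha => ?_)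
    (fun a b c _ _ _ h h' => h.trans h') (fun a b _ _ h => h.symm) hx hy
  have haK : a ∈ Kᶜ := fun h => disjoint_left.1 hSK ha h
  obtain ⟨ε, hε, hball⟩ := Metric.isOpen_iff.1 hK.isClosed.isOpen_compl a haK
  filter_upwards [mem_nhdsWithin_of_mem_nhds (ball_mem_nhds a hε)] with b hb
  refine HasRatioLog.symm ?_
  have hne : ∀ z ∈ K, z - a ≠ 0 := fun z hz h => haK (by rwa [sub_eq_zero.1 h] at hz)
  -- For `b` closer to `a` than `K` is, the quotient lies within distance `1` of `1`, where the
  -- principal logarithm is continuous.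
  have hslit : ∀ z ∈ K, (z - b) / (z - a) ∈ Complex.slitPlane := by
    intro z hz
    have h1 : ε ≤ dist z a := by
      by_contra hlt
      exact hball (mem_ball.2 (not_le.1 hlt)) hz
    have h2 : ‖(a - b) / (z - a)‖ < 1 := by
      rw [norm_div, div_lt_one (norm_pos_iff.2 (hne z hz)), ← dist_eq_norm, ← dist_eq_norm,
        dist_comm a b]
      exact lt_of_lt_of_le (mem_ball.1 hb) h1
    have h3 : (z - b) / (z - a) = 1 + (a - b) / (z - a) := by
      have := hne z hz
      field_simp
      ring
    rw [h3]
    exact Complex.mem_slitPlane_of_norm_lt_one h2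
  refine ⟨fun z => Complex.log ((z - b) / (z - a)), ?_, fun z hz => ?_⟩
  · refine ContinuousOn.clog (ContinuousOn.div (by fun_prop) (by fun_prop) hne) hslit
  · rw [Complex.exp_log (Complex.slitPlane_ne_zero (hslit z hz)), div_mul_cancel₀ _ (hne z hz)]

theorem closure_connectedComponentIn_inter_subset {X : Type*} [TopologicalSpace X] {S : Set X}
    {x : X} : closure (connectedComponentIn S x) ∩ S ⊆ connectedComponentIn S x := by
  rintro z ⟨hz, hzS⟩
  by_cases hx : x ∈ S
  · refine (isPreconnected_connectedComponentIn.subset_closure (t := insert z (connectedComponentIn S x))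
      (subset_insert _ _) (insert_subset hz subset_closure)).subset_connectedComponentIn
      (mem_insert_of_mem _ (mem_connectedComponentIn hx))
      (insert_subset hzS (connectedComponentIn_subset _ _)) (mem_insert _ _)
  · simp [connectedComponentIn_eq_empty hx] at hz

/-- Lifting `f` along the covering `exp` of the punctured plane. -/
theorem exists_continuous_log {X : Type*} [TopologicalSpace X] [SimplyConnectedSpace X]
    [LocallyPathConnectedSpace X] {f : X → ℂ} (hf : Continuous f) (h0 : ∀ x, f x ≠ 0) :
    ∃ L : X → ℂ, Continuous L ∧ ∀ x, Complex.exp (L x) = f x := by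
  obtain ⟨x₀⟩ := (inferInstance : Nonempty X)
  obtain ⟨F, ⟨-, hF⟩, -⟩ := Complex.isCoveringMapOn_exp.existsUnique_continuousMap_lifts
    ⟨f, hf⟩ (a₀ := x₀) (e₀ := Complex.log (f x₀)) (Complex.exp_log (h0 x₀)) (fun x => h0 x)
  exact ⟨F, F.continuous, fun x => congrFun hF x⟩

theorem eq_of_exp_comp_const {φ : ℝ → ℂ} (hφ : Continuous φ) {a : ℂ}
    (h : ∀ t, Complex.exp (φ t) = a) (s t : ℝ) : φ s = φ t := by
  have hc := Complex.isCoveringMap_exp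
  have hsep := hc.isSeparatedMap
  have hinj := hc.isLocalHomeomorph.isLocallyInjective
  refine hsep.const_of_comp hinj hφ (fun u v => ?_) s t
  simp [h u, h v]

/-- A nowhere vanishing continuous function on the plane does not agree with `z - x` on a circle
around `x`. -/
theorem exists_ne_sub_of_ne_zero {h : ℂ → ℂ} (hc : Continuous h) (h0 : ∀ z, h z ≠ 0) (x : ℂ)
    {R : ℝ} (hR : 0 < R) : ∃ z ∈ sphere x R, h z ≠ z - x := by
  by_contra! hcon
  obtain ⟨L, hL, hLe⟩ := exists_continuous_log hc h0
  -- `φ` is a logarithm of the constant `R`, hence constant; yet one turn around the circle changes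
  -- it by `-2πi`.
  set φ : ℝ → ℂ := fun θ => L (circleMap x R θ) - θ * Complex.I with hφ
  have hφc : Continuous φ := by
    have := continuous_circleMap x R
    fun_prop
  have hconst := eq_of_exp_comp_const hφc (a := (R : ℂ)) (fun θ => by
    rw [hφ]
    simp only
    rw [Complex.exp_sub, hLe, hcon _ (circleMap_mem_sphere x hR.le θ), circleMap_sub_center,
      circleMap_zero, mul_div_assoc, div_self (Complex.exp_ne_zero _), mul_one]) 0 (2 * Real.pi)
  have hper : circleMap x R (2 * Real.pi) = circleMap x R 0 := by
    simpa using periodic_circleMap x R 0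
  simp only [hφ, hper, Complex.ofReal_zero, zero_mul, sub_zero] at hconst
  have h2 : ((2 * Real.pi : ℝ) : ℂ) * Complex.I = 0 := by linear_combination hconst
  simp [Real.pi_ne_zero] at h2

/-- A bounded component of the complement of `K` is detected by the logarithm criterion. -/
theorem not_hasRatioLog_of_isBounded {K : Set ℂ} (hK : IsClosed K) {x y : ℂ} (hx : x ∉ K)
    (hy : y ∉ K) (hb : Bornology.IsBounded (connectedComponentIn Kᶜ x))
    (hxy : y ∉ connectedComponentIn Kᶜ x) : ¬ HasRatioLog K x y := by
  classical
  rintro ⟨L, hL, hLe⟩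
  -- Tietze extension of the logarithm to the whole plane.
  obtain ⟨M, hM⟩ := ContinuousMap.exists_restrict_eq hK
    (⟨K.domRestrict L, continuousOn_iff_continuous_domRestrict.1 hL⟩ : C(K, ℂ))
  have hML : ∀ z ∈ K, M z = L z := fun z hz => congrArg (fun f : C(K, ℂ) => f ⟨z, hz⟩) hM
  set U := connectedComponentIn Kᶜ x with hU
  have hxU : x ∈ U := mem_connectedComponentIn hx
  have hfr : ∀ z ∈ frontier U, z ∈ K := by
    intro z hz
    by_contra hzK
    have hUo : IsOpen U := hK.isOpen_compl.connectedComponentIn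
    rw [hUo.frontier_eq] at hz
    exact hz.2 (closure_connectedComponentIn_inter_subset ⟨hz.1, hzK⟩)
  -- The two formulas agree on `K`, which contains the frontier of `U`. Neither vanishes where it is
  -- used, since `y ∉ U` and `x ∈ U`. As `U` is bounded, `h` is `z - x` on large circles.
  set h : ℂ → ℂ := fun z => if z ∈ U then Complex.exp (M z) * (z - y) else z - x with hh
  have hc : Continuous h := by
    refine Continuous.if (fun z hz => ?_) (by fun_prop) (by fun_prop)
    have := hfr z hz
    rw [hML z this, hLe z this]
  have h0 : ∀ z, h z ≠ 0 := by
    intro z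
    by_cases hz : z ∈ U
    · simp only [hh, hz, if_true]
      refine mul_ne_zero (Complex.exp_ne_zero _) (sub_ne_zero.2 ?_)
      rintro rfl
      exact hxy hz
    · simp only [hh, hz, if_false]
      refine sub_ne_zero.2 ?_
      rintro rfl
      exact hz hxU
  obtain ⟨R, hR, hUR⟩ := hb.subset_ball_lt 0 x
  obtain ⟨z, hz, hne⟩ := exists_ne_sub_of_ne_zero hc h0 x hR
  refine hne ?_
  have hzU : z ∉ U := fun hzU => by
    have h1 := mem_ball.1 (hUR hzU)
    rw [mem_sphere.1 hz] at h1
    exact lt_irrefl _ h1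
  simp [hh, hzU]

/-- The exterior of a disc is the image of a half-plane under `exp`. -/
theorem isPreconnected_compl_closedBall_zero {R : ℝ} (hR : 0 < R) :
    IsPreconnected (closedBall (0 : ℂ) R)ᶜ := by
  have h : (closedBall (0 : ℂ) R)ᶜ = Complex.exp '' {w | Real.log R < w.re} := by
    ext z
    simp only [mem_compl_iff, mem_closedBall, dist_zero_right, not_le, mem_image, mem_ofPred_eq]
    constructor
    · intro hz
      have hz0 : z ≠ 0 := by
        rintro rfl
        rw [norm_zero] at hz
        exact lt_asymm hz hR
      exact ⟨Complex.log z, by rw [Complex.log_re]; exact Real.log_lt_log hR hz, Complex.exp_log hz0⟩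
    · rintro ⟨w, hw, rfl⟩
      rw [Complex.norm_exp]
      exact (Real.log_lt_iff_lt_exp hR).1 hw
  rw [h]
  exact (convex_halfSpace_re_gt _).isPreconnected.image _ Complex.continuous_exp.continuousOn

/-- **Eilenberg's criterion**: points that satisfy the logarithm criterion are not separated. -/
theorem HasRatioLog.mem_connectedComponentIn {K : Set ℂ} (hK : IsCompact K) {x y : ℂ} (hx : x ∉ K)
    (hy : y ∉ K) (h : HasRatioLog K x y) : y ∈ connectedComponentIn Kᶜ x := by
  by_contra hxy
  have hyx : x ∉ connectedComponentIn Kᶜ y := fun h' => hxy <| by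
    rw [← connectedComponentIn_eq h']
    exact _root_.mem_connectedComponentIn hy
  have hbx : ¬ Bornology.IsBounded (connectedComponentIn Kᶜ x) := fun hb =>
    not_hasRatioLog_of_isBounded hK.isClosed hx hy hb hxy h
  have hby : ¬ Bornology.IsBounded (connectedComponentIn Kᶜ y) := fun hb =>
    not_hasRatioLog_of_isBounded hK.isClosed hy hx hb hyx h.symm
  obtain ⟨R, hR, hKR⟩ := hK.isBounded.subset_closedBall_lt 0 0
  -- Both components are unbounded, so both meet the connected exterior of a disc containing `K`,
  -- and must coincide.
  have key : ∀ w : ℂ, ¬ Bornology.IsBounded (connectedComponentIn Kᶜ w) →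
      ∃ a ∈ (closedBall (0 : ℂ) R)ᶜ, a ∈ connectedComponentIn Kᶜ w := by
    intro w hw
    by_contra! hcon
    refine hw ((isBounded_closedBall (x := (0 : ℂ)) (r := R)).subset fun a ha => ?_)
    by_contra h'
    exact hcon a h' ha
  obtain ⟨a, haR, ha⟩ := key x hbx
  obtain ⟨b, hbR, hb⟩ := key y hby
  have h1 := (isPreconnected_compl_closedBall_zero hR).subset_connectedComponentIn haR
    (compl_subset_compl.2 hKR) hbR
  rw [← connectedComponentIn_eq ha] at h1
  refine hxy ?_
  rw [connectedComponentIn_eq h1, ← connectedComponentIn_eq hb]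
  exact _root_.mem_connectedComponentIn hy

/-! ### Arcs in the plane. -/

/-- An arc in the plane has a continuous left inverse defined on the whole plane. -/
theorem exists_arc_leftInverse {γ : ℝ → ℂ} {a b : ℝ} (hγ : ContinuousOn γ (Icc a b))
    (hinj : InjOn γ (Icc a b)) : ∃ r : C(ℂ, ℝ), ∀ t ∈ Icc a b, r (γ t) = t := by
  have he : IsClosedEmbedding ((Icc a b).domRestrict γ) :=
    (continuousOn_iff_continuous_domRestrict.1 hγ).isClosedEmbedding
      (injOn_iff_injective.1 hinj)
  obtain ⟨r, hr⟩ := ContinuousMap.exists_extension he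
    (⟨Subtype.val, continuous_subtype_val⟩ : C(Icc a b, ℝ))
  exact ⟨r, fun t ht => congrArg (fun f : C(Icc a b, ℝ) => f ⟨t, ht⟩) hr⟩

/-- The logarithm exists along the parameter interval; the left inverse of the arc carries it to the
plane. -/
theorem HasRatioLog.arc {γ : ℝ → ℂ} {a b : ℝ} (hab : a ≤ b) (hγ : ContinuousOn γ (Icc a b))
    (hinj : InjOn γ (Icc a b)) {x y : ℂ} (hx : x ∉ γ '' Icc a b) (hy : y ∉ γ '' Icc a b) :
    HasRatioLog (γ '' Icc a b) x y := by
  obtain ⟨r, hr⟩ := exists_arc_leftInverse hγ hinj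
  have hne : ∀ w, w ∉ γ '' Icc a b → ∀ t ∈ Icc a b, γ t - w ≠ 0 := fun w hw t ht h =>
    hw ⟨t, ht, sub_eq_zero.1 h⟩
  set f : Icc a b → ℂ := fun t => (γ t - x) / (γ t - y) with hf
  have hfc : Continuous f := by
    have := continuousOn_iff_continuous_domRestrict.1 hγ
    exact Continuous.div (this.sub continuous_const) (this.sub continuous_const)
      (fun t => hne y hy t t.2)
  obtain ⟨L, hL, hLe⟩ := exists_continuous_log (f := IccExtend hab f) (hfc.Icc_extend')
    (fun t => div_ne_zero (hne x hx _ (projIcc a b hab t).2) (hne y hy _ (projIcc a b hab t).2))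
  refine ⟨fun z => L (r z), by fun_prop, ?_⟩
  rintro _ ⟨t, ht, rfl⟩
  simp only
  rw [hr t ht, hLe, IccExtend_of_mem hab f ht]
  exact div_mul_cancel₀ _ (hne y hy t ht)

/-- At the common point `u` the two logarithms differ by a period of `exp`; shifting one by that
period makes them agree. -/
theorem HasRatioLog.union {K A : Set ℂ} (hK : IsClosed K) (hA : IsClosed A) {x y u : ℂ}
    (hyK : y ∉ K)
    (hu : u ∈ K) (huA : u ∈ A) (hKA : K ∩ A ⊆ {u}) (h : HasRatioLog K x y)
    (h' : HasRatioLog A x y) : HasRatioLog (K ∪ A) x y := by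
  classical
  obtain ⟨L, hL, hLe⟩ := h
  obtain ⟨M, hM, hMe⟩ := h'
  have huy : u - y ≠ 0 := fun h => hyK (by rwa [← sub_eq_zero.1 h])
  have hexp : Complex.exp (L u - M u) = 1 := by
    have : Complex.exp (L u) = Complex.exp (M u) :=
      mul_right_cancel₀ huy ((hLe u hu).trans (hMe u huA).symm)
    rw [Complex.exp_sub, this, div_self (Complex.exp_ne_zero _)]
  set N : ℂ → ℂ := fun z => if z ∈ K then L z else M z + (L u - M u) with hN
  have hNK : EqOn N L K := fun z hz => by simp [hN, hz]
  have hNA : EqOn N (fun z => M z + (L u - M u)) A := by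
    intro z hz
    by_cases hzK : z ∈ K
    · obtain rfl : z = u := hKA ⟨hzK, hz⟩
      simp [hN, hzK]
    · simp [hN, hzK]
  refine ⟨N, ContinuousOn.union_of_isClosed (hL.congr hNK)
    ((hM.add continuousOn_const).congr hNA) hK hA, ?_⟩
  rintro z (hz | hz)
  · rw [hNK hz, hLe z hz]
  · rw [hNA hz]
    simp only
    rw [Complex.exp_add, hexp, mul_one, hMe z hz]

/-- Removing a point `p` of intermediate value leaves the plane connected, so that value is taken
again. -/
theorem not_injective_of_continuous_complex_real {φ : ℂ → ℝ} (hφ : Continuous φ) :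
    ¬ Function.Injective φ := by
  intro hinj
  have h01 : φ 0 ≠ φ 1 := fun h => zero_ne_one (hinj h)
  have hmid : (φ 0 + φ 1) / 2 ∈ φ '' univ := by
    refine (isPreconnected_univ.image φ hφ.continuousOn).ordConnected.uIcc_subset
      (mem_image_of_mem φ (mem_univ 0)) (mem_image_of_mem φ (mem_univ 1)) ?_
    rw [mem_uIcc]
    rcases le_total (φ 0) (φ 1) with h | h
    · left; constructor <;> linarith
    · right; constructor <;> linarith
  obtain ⟨p, -, hp⟩ := hmid
  have hp0 : (0 : ℂ) ∈ ({p}ᶜ : Set ℂ) := by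
    rintro rfl
    apply h01; linarith
  have hp1 : (1 : ℂ) ∈ ({p}ᶜ : Set ℂ) := by
    rintro rfl
    apply h01; linarith
  have hconn : IsPreconnected ({p}ᶜ : Set ℂ) :=
    (isConnected_compl_singleton_of_one_lt_rank (by simp) p).isPreconnected
  have hmid' : φ p ∈ φ '' {p}ᶜ := by
    refine (hconn.image φ hφ.continuousOn).ordConnected.uIcc_subset
      (mem_image_of_mem φ hp0) (mem_image_of_mem φ hp1) ?_
    rw [mem_uIcc]
    rcases le_total (φ 0) (φ 1) with h | h
    · left; constructor <;> linarith
    · right; constructor <;> linarith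
  obtain ⟨q, hq, hqp⟩ := hmid'
  exact hq (hinj hqp)

theorem interior_arc_eq_empty {γ : ℝ → ℂ} {a b : ℝ} (hγ : ContinuousOn γ (Icc a b))
    (hinj : InjOn γ (Icc a b)) : interior (γ '' Icc a b) = ∅ := by
  by_contra hne
  obtain ⟨z, hz⟩ := nonempty_iff_ne_empty.2 hne
  obtain ⟨ε, hε, hball⟩ := Metric.isOpen_iff.1 isOpen_interior z hz
  obtain ⟨r, hr⟩ := exists_arc_leftInverse hγ hinj
  -- A disc inside the arc would give, via the left inverse `r`, a continuous injection of the plane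
  -- into `ℝ`.
  let ψ := OpenPartialHomeomorph.univBall z ε
  have hψ : ∀ w, ψ w ∈ γ '' Icc a b := fun w => interior_subset <| hball <| by
    rw [← OpenPartialHomeomorph.univBall_target z hε]
    exact ψ.map_source (by simp [ψ])
  refine not_injective_of_continuous_complex_real
    (r.continuous.comp (OpenPartialHomeomorph.continuous_univBall z ε)) fun v w hvw => ?_
  obtain ⟨s, hs, hsv⟩ := hψ v
  obtain ⟨t, ht, htw⟩ := hψ w
  have : ψ v = ψ w := by
    have h1 : r (ψ v) = r (ψ w) := hvw
    rw [← hsv, ← htw, hr s hs, hr t ht] at h1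
    rw [← hsv, ← htw, h1]
  exact ψ.injOn (by simp [ψ]) (by simp [ψ]) this

/-- Extending a compact set by an arc that meets it in one point does not separate points. -/
theorem mem_connectedComponentIn_compl_union_arc {K : Set ℂ} (hK : IsCompact K) {γ : ℝ → ℂ}
    {a b : ℝ} (hab : a ≤ b) (hγ : ContinuousOn γ (Icc a b)) (hinj : InjOn γ (Icc a b)) {u x y : ℂ}
    (hu : u ∈ K) (huA : u ∈ γ '' Icc a b) (hKA : K ∩ γ '' Icc a b ⊆ {u}) (hx : x ∉ γ '' Icc a b)
    (hy : y ∉ γ '' Icc a b) (hxK : x ∉ K) (hxy : y ∈ connectedComponentIn Kᶜ x) :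
    y ∈ connectedComponentIn (K ∪ γ '' Icc a b)ᶜ x := by
  have hA : IsCompact (γ '' Icc a b) := isCompact_Icc.image_of_continuousOn hγ
  have hyK : y ∉ K := connectedComponentIn_subset _ _ hxy
  have hlog : HasRatioLog K x y := HasRatioLog.of_isPreconnected hK
    isPreconnected_connectedComponentIn
    (disjoint_left.2 fun z hz => connectedComponentIn_subset _ _ hz)
    (mem_connectedComponentIn hxK) hxy
  refine (hlog.union hK.isClosed hA.isClosed hyK hu huA hKA
    (HasRatioLog.arc hab hγ hinj hx hy)).mem_connectedComponentIn (hK.union hA) ?_ ?_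
  · exact fun h => h.elim hxK hx
  · exact fun h => h.elim hyK hy

/-- An arc that meets a compact set `K` exactly in its two ends lies on the boundary of a single
component of the complement of the union. -/
theorem exists_component_arc_subset_closure {K : Set ℂ} (hK : IsCompact K) {γ : ℝ → ℂ} {a b : ℝ}
    (hab : a < b) (hγ : ContinuousOn γ (Icc a b)) (hinj : InjOn γ (Icc a b))
    (ha : γ a ∈ K) (hb : γ b ∈ K) (hKγ : ∀ t ∈ Ioo a b, γ t ∉ K) :
    ∃ w ∈ (K ∪ γ '' Icc a b)ᶜ,
      γ '' Icc a b ⊆ closure (connectedComponentIn (K ∪ γ '' Icc a b)ᶜ w) := by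
  have hA : IsCompact (γ '' Icc a b) := isCompact_Icc.image_of_continuousOn hγ
  obtain ⟨m₀, hm₀⟩ := nonempty_Ioo.2 hab
  set W := connectedComponentIn Kᶜ (γ m₀) with hW
  have hWo : IsOpen W := hK.isClosed.isOpen_compl.connectedComponentIn
  have hmW : γ '' Ioo a b ⊆ W :=
    (isPreconnected_Ioo.image γ (hγ.mono Ioo_subset_Icc_self)).subset_connectedComponentIn
      (mem_image_of_mem γ hm₀) (by rintro _ ⟨t, ht, rfl⟩; exact hKγ t ht)
  obtain ⟨w, hwW, hwA⟩ : ∃ w ∈ W, w ∉ γ '' Icc a b := by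
    by_contra! hcon
    have h1 : γ m₀ ∈ interior (γ '' Icc a b) :=
      interior_maximal hcon hWo (hmW (mem_image_of_mem γ hm₀))
    rw [interior_arc_eq_empty hγ hinj] at h1
    exact h1
  have hwK : w ∉ K := connectedComponentIn_subset _ _ hwW
  have hw : w ∈ (K ∪ γ '' Icc a b)ᶜ := fun h => h.elim hwK hwA
  refine ⟨w, hw, ?_⟩
  set F := connectedComponentIn (K ∪ γ '' Icc a b)ᶜ w with hF
  have hFo : IsOpen F := (hK.union hA).isClosed.isOpen_compl.connectedComponentIn
  have hFsub : F ⊆ (K ∪ γ '' Icc a b)ᶜ := connectedComponentIn_subset _ _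
  have hwF : w ∈ F := mem_connectedComponentIn hw
  suffices hint : γ '' Ioo a b ⊆ closure F by
    have h2 : Icc a b = closure (Ioo a b) := (closure_Ioo hab.ne).symm
    have h3 : γ '' closure (Ioo a b) ⊆ closure (γ '' Ioo a b) :=
      ContinuousOn.image_closure (by rwa [← h2])
    rw [h2] at *
    exact h3.trans (closure_minimal hint isClosed_closure)
  rintro _ ⟨m, hm, rfl⟩
  by_contra hcl
  have hat : ContinuousAt γ m := hγ.continuousAt (Icc_mem_nhds hm.1 hm.2)
  have hev : ∀ᶠ t in 𝓝 m, γ t ∈ (closure F)ᶜ ∧ t ∈ Ioo a b :=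
    (hat.eventually (isClosed_closure.isOpen_compl.mem_nhds hcl)).and (Ioo_mem_nhds hm.1 hm.2)
  obtain ⟨ε, hε, hεb⟩ := Metric.eventually_nhds_iff_ball.1 hev
  set p := m - ε / 2 with hp
  set q := m + ε / 2 with hq
  have hmem : ∀ t ∈ Icc p q, γ t ∉ closure F ∧ t ∈ Ioo a b := by
    intro t ht
    refine hεb t ?_
    rw [mem_ball, Real.dist_eq, abs_lt]
    constructor <;> linarith [ht.1, ht.2]
  have hpab : p ∈ Ioo a b := (hmem p ⟨le_rfl, by linarith⟩).2
  have hqab : q ∈ Ioo a b := (hmem q ⟨by linarith, le_rfl⟩).2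
  have hpm : p < m := by linarith
  have hmq : m < q := by linarith
  have hs1 : Icc a p ⊆ Icc a b := Icc_subset_Icc_right hpab.2.le
  have hs2 : Icc q b ⊆ Icc a b := Icc_subset_Icc_left hqab.1.le
  have hmab : m ∈ Icc a b := Ioo_subset_Icc_self hm
  have hm1 : γ m ∉ γ '' Icc a p := by
    rintro ⟨t, ht, htm⟩
    have := hinj (hs1 ht) hmab htm
    linarith [ht.2]
  have hm2 : γ m ∉ γ '' Icc q b := by
    rintro ⟨t, ht, htm⟩
    have := hinj (hs2 ht) hmab htm
    linarith [ht.1]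
  have hK1 : γ m ∈ connectedComponentIn Kᶜ w := by
    rw [hW] at hwW
    rw [← connectedComponentIn_eq hwW]
    exact hmW (mem_image_of_mem γ hm)
  have hK2 := mem_connectedComponentIn_compl_union_arc hK hpab.1.le (hγ.mono hs1) (hinj.mono hs1)
    ha (mem_image_of_mem γ (left_mem_Icc.2 hpab.1.le))
    (by
      rintro _ ⟨hz, t, ht, rfl⟩
      by_contra hne
      have hta : t ≠ a := by rintro rfl; exact hne rfl
      exact hKγ t ⟨lt_of_le_of_ne ht.1 hta.symm, ht.2.trans_lt hpab.2⟩ hz)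
    (fun h => hwA (image_mono hs1 h)) hm1 hwK hK1
  have hA1 : IsCompact (γ '' Icc a p) := isCompact_Icc.image_of_continuousOn (hγ.mono hs1)
  have hA2 : IsCompact (γ '' Icc q b) := isCompact_Icc.image_of_continuousOn (hγ.mono hs2)
  have hwK1 : w ∉ K ∪ γ '' Icc a p := fun h => h.elim hwK (fun h => hwA (image_mono hs1 h))
  have hK3 := mem_connectedComponentIn_compl_union_arc (hK.union hA1) hqab.2.le (hγ.mono hs2)
    (hinj.mono hs2) (Or.inl hb) (mem_image_of_mem γ (right_mem_Icc.2 hqab.2.le))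
    (by
      rintro _ ⟨hz, t, ht, rfl⟩
      by_contra hne
      have htb : t ≠ b := by rintro rfl; exact hne rfl
      rcases hz with hz | ⟨s, hs, hst⟩
      · exact hKγ t ⟨hqab.1.trans_le ht.1, lt_of_le_of_ne ht.2 htb⟩ hz
      · have := hinj (hs1 hs) (hs2 ht) hst
        linarith [hs.2, ht.1])
    (fun h => hwA (image_mono hs2 h)) hm2 hwK1 hK2
  set C := connectedComponentIn (K ∪ γ '' Icc a p ∪ γ '' Icc q b)ᶜ w with hC
  -- Points of `C` on the arc lie over `(p, q)`, away from `closure F`; hence `F` is clopen relative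
  -- to `C`.
  have hCF : C ⊆ F := by
    refine isPreconnected_connectedComponentIn.subset_of_closure_inter_subset hFo ⟨w, ?_, hwF⟩ ?_
    · exact mem_connectedComponentIn fun h =>
        h.elim hwK1 (fun h => hwA (image_mono hs2 h))
    · rintro z ⟨hzF, hzC⟩
      refine closure_connectedComponentIn_inter_subset ⟨hzF, ?_⟩
      have hz := connectedComponentIn_subset _ _ hzC
      rintro (h | ⟨t, ht, rfl⟩)
      · exact hz (Or.inl (Or.inl h))
      · rcases le_total t p with h | h
        · exact hz (Or.inl (Or.inr ⟨t, ⟨ht.1, h⟩, rfl⟩))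
        · rcases le_total q t with h' | h'
          · exact hz (Or.inr ⟨t, ⟨h', ht.2⟩, rfl⟩)
          · exact (hmem t ⟨h, h'⟩).1 hzF
  exact hFsub (hCF hK3) (Or.inr (mem_image_of_mem γ hmab))

/-! ### Face-distance along edges. -/

namespace PlaneDrawing

variable {α β : Type*} {G : Graph α β} (D : PlaneDrawing G)

theorem CrossAt.symm {D : PlaneDrawing G} {e f : β} {z : ℂ} (h : D.CrossAt e f z) :
    D.CrossAt f e z :=
  ⟨h.2.1, h.1, h.2.2.1.symm, h.2.2.2.2, h.2.2.2.1⟩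

theorem faceDist_self (u : D.PVertex) : D.faceDist u u = 0 := by
  refine le_antisymm (iInf_le_of_le .nil ?_) zero_le
  simp

theorem faceDist_comm (u v : D.PVertex) : D.faceDist u v = D.faceDist v u := by
  have key : ∀ u v : D.PVertex, D.faceDist u v ≤ D.faceDist v u := fun u v =>
    le_iInf fun p => iInf_le_of_le p.reverse (by simp)
  exact le_antisymm (key u v) (key v u)

theorem faceDist_triangle (u v w : D.PVertex) :
    D.faceDist u w ≤ D.faceDist u v + D.faceDist v w := by
  refine ENat.le_iInf_add_iInf fun p q => iInf_le_of_le (p.append q) ?_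
  rw [SimpleGraph.Walk.support_append, List.countP_append, Nat.cast_add]
  gcongr
  exact (List.tail_sublist _).countP_le

theorem faceDist_le_one {u v : D.PVertex} {F : Set ℂ} (hF : F ∈ D.faceSet)
    (hu : (u : ℂ) ∈ frontier F) (hv : (v : ℂ) ∈ frontier F) : D.faceDist u v ≤ 1 := by
  have h1 : D.radialGraph.Adj (.inl u) (.inr ⟨F, hF⟩) := hu
  have h2 : D.radialGraph.Adj (.inr ⟨F, hF⟩) (.inl v) := hv
  refine iInf_le_of_le (.cons h1 (.cons h2 .nil)) ?_
  simp [List.countP_cons]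

/-- The parameters of the vertices of the planarization on the edge `e`. -/
def params (e : β) : Set ℝ := {t | t ∈ Icc (0 : ℝ) 1 ∧ D.curve e t ∈ D.planarVertexSet}

/-- The vertex of the planarization with parameter `t` on the edge `e`. -/
def vertexAt (e : β) (t : ℝ) (ht : t ∈ D.params e) : D.PVertex := ⟨D.curve e t, ht.2⟩

variable {D}

theorem curve_mem_planarVertexSet_of_end {e : β} (he : e ∈ E(G)) :
    D.curve e 0 ∈ D.planarVertexSet ∧ D.curve e 1 ∈ D.planarVertexSet := by
  obtain ⟨x, y, hl, h0, h1⟩ := D.curve_ends e he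
  rw [h0, h1]
  exact ⟨Or.inl (mem_image_of_mem _ hl.left_mem), Or.inl (mem_image_of_mem _ hl.right_mem)⟩

theorem zero_mem_params {e : β} (he : e ∈ E(G)) : 0 ∈ D.params e :=
  ⟨by simp, (curve_mem_planarVertexSet_of_end he).1⟩

theorem one_mem_params {e : β} (he : e ∈ E(G)) : 1 ∈ D.params e :=
  ⟨by simp, (curve_mem_planarVertexSet_of_end he).2⟩

theorem exists_crossAt_of_mem_params {e : β} (he : e ∈ E(G)) {t : ℝ} (ht : t ∈ D.params e)
    (ht' : t ∈ Ioo (0 : ℝ) 1) : ∃ f, D.CrossAt e f (D.curve e t) := by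
  rcases ht.2 with ⟨x, hx, hxt⟩ | ⟨f, g, hfg⟩
  · exact absurd hxt.symm (D.curve_ne_point e he t ht' x hx)
  · by_cases hef : e = f
    · exact ⟨g, hef ▸ hfg⟩
    · exact ⟨f, he, hfg.1, hef, mem_image_of_mem _ ht', hfg.2.2.2.1⟩

theorem encard_params_inter_Ioo_le {k : ℕ} (hk : D.IsKPlane k) {e : β} (he : e ∈ E(G)) :
    (D.params e ∩ Ioo 0 1).encard ≤ k := by
  have hinj : InjOn (D.curve e) (D.params e ∩ Ioo 0 1) :=
    (D.curve_injOn e he).mono fun t ht => ht.1.1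
  rw [← hinj.encard_image]
  refine (encard_le_encard ?_).trans (hk e he)
  rintro _ ⟨t, ht, rfl⟩
  exact exists_crossAt_of_mem_params he ht.1 ht.2

/-- The extra one is the end at parameter `1`. -/
theorem encard_params_inter_Ioc_le {k : ℕ} (hk : D.IsKPlane k) {e : β} (he : e ∈ E(G)) :
    (D.params e ∩ Ioc 0 1).encard ≤ k + 1 := by
  have hsub : D.params e ∩ Ioc 0 1 ⊆ insert 1 (D.params e ∩ Ioo 0 1) := by
    rintro t ⟨ht, h0, h1⟩
    rcases h1.eq_or_lt with rfl | h1
    · exact mem_insert _ _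
    · exact mem_insert_of_mem _ ⟨ht, h0, h1⟩
  calc _ ≤ _ := encard_le_encard hsub
    _ ≤ _ := encard_insert_le _ _
    _ ≤ _ := by gcongr; exact encard_params_inter_Ioo_le hk he

theorem curve_mem_carrier {e : β} (he : e ∈ E(G)) {t : ℝ} (ht : t ∈ Icc (0 : ℝ) 1) :
    D.curve e t ∈ D.carrier :=
  Or.inr (mem_biUnion he (mem_image_of_mem _ ht))

theorem isCompact_curve_image {e : β} (he : e ∈ E(G)) {S : Set ℝ} (hS : IsCompact S)
    (hS' : S ⊆ Icc 0 1) : IsCompact (D.curve e '' S) :=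
  hS.image_of_continuousOn ((D.curve_continuousOn e he).mono hS')

theorem isCompact_carrier (hV : V(G).Finite) (hE : E(G).Finite) : IsCompact D.carrier :=
  (hV.image _).isCompact.union
    (hE.isCompact_biUnion fun _ he => isCompact_curve_image he isCompact_Icc subset_rfl)

/-- Consecutive vertices of the planarization on an edge lie on the boundary of a common face. -/
theorem faceDist_le_one_of_consecutive (hV : V(G).Finite) (hE : E(G).Finite) {e : β}
    (he : e ∈ E(G)) {s t : ℝ} (hs : s ∈ D.params e) (ht : t ∈ D.params e) (hst : s < t)
    (hno : ∀ r ∈ Ioo s t, r ∉ D.params e) :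
    D.faceDist (D.vertexAt e s hs) (D.vertexAt e t ht) ≤ 1 := by
  have hs01 := hs.1
  have ht01 := ht.1
  have hsub : Icc s t ⊆ Icc (0 : ℝ) 1 := Icc_subset_Icc hs01.1 ht01.2
  set R : Set ℝ := {0, 1} ∪ (Icc 0 s ∪ Icc t 1) with hR
  have hRsub : R ⊆ Icc (0 : ℝ) 1 := by
    rintro r ((rfl | rfl) | h | h)
    · simp
    · simp
    · exact ⟨h.1, h.2.trans hs01.2⟩
    · exact ⟨ht01.1.trans h.1, h.2⟩
  have hRc : IsCompact R :=
    (toFinite _).isCompact.union (isCompact_Icc.union isCompact_Icc)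
  -- `K` is the drawing without the open segment between the two vertices.
  set K : Set ℂ := D.point '' V(G) ∪
    ((⋃ f ∈ E(G) \ {e}, D.curve f '' Icc 0 1) ∪ D.curve e '' R) with hKdef
  have hK : IsCompact K := (hV.image _).isCompact.union
    (((hE.subset sdiff_subset).isCompact_biUnion fun _ hf =>
      isCompact_curve_image hf.1 isCompact_Icc subset_rfl).union
      (isCompact_curve_image he hRc hRsub))
  have hcar : K ∪ D.curve e '' Icc s t = D.carrier := by
    apply subset_antisymm
    · rintro z ((h | h | h) | h)
      · exact Or.inl h
      · obtain ⟨f, hf, hz⟩ := mem_iUnion₂.1 h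
        exact Or.inr (mem_biUnion hf.1 hz)
      · obtain ⟨r, hr, rfl⟩ := h
        exact curve_mem_carrier he (hRsub hr)
      · obtain ⟨r, hr, rfl⟩ := h
        exact curve_mem_carrier he (hsub hr)
    · rintro z (h | h)
      · exact Or.inl (Or.inl h)
      · obtain ⟨f, hf, hz⟩ := mem_iUnion₂.1 h
        by_cases hfe : f = e
        · subst hfe
          obtain ⟨r, hr, rfl⟩ := hz
          rcases le_total r s with h1 | h1
          · exact Or.inl (Or.inr (Or.inr ⟨r, Or.inr (Or.inl ⟨hr.1, h1⟩), rfl⟩))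
          · rcases le_total r t with h2 | h2
            · exact Or.inr ⟨r, ⟨h1, h2⟩, rfl⟩
            · exact Or.inl (Or.inr (Or.inr ⟨r, Or.inr (Or.inr ⟨h2, hr.2⟩), rfl⟩))
        · exact Or.inl (Or.inr (Or.inl (mem_biUnion (show f ∈ E(G) \ {e} from ⟨hf, hfe⟩) hz)))
  have hdisj : ∀ r ∈ Ioo s t, D.curve e r ∉ K := by
    intro r hr hrK
    have hr01 : r ∈ Ioo (0 : ℝ) 1 := ⟨hs01.1.trans_lt hr.1, hr.2.trans_le ht01.2⟩
    rcases hrK with ⟨x, hx, hxr⟩ | h | ⟨q, hq, hqr⟩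
    · exact D.curve_ne_point e he r hr01 x hx hxr.symm
    · obtain ⟨f, hf, q, hq, hqr⟩ := mem_iUnion₂.1 h
      obtain ⟨x, y, hl, hx, hy⟩ := D.curve_ends f hf.1
      rcases hq.1.eq_or_lt with rfl | hq0
      · exact D.curve_ne_point e he r hr01 x hl.left_mem (hqr.symm.trans hx)
      rcases hq.2.eq_or_lt with rfl | hq1
      · exact D.curve_ne_point e he r hr01 y hl.right_mem (hqr.symm.trans hy)
      refine hno r hr ⟨Ioo_subset_Icc_self hr01, Or.inr ⟨e, f, he, hf.1, fun h => hf.2 h.symm,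
        mem_image_of_mem _ hr01, q, ⟨hq0, hq1⟩, hqr⟩⟩
    · obtain rfl := D.curve_injOn e he (hRsub hq) (Ioo_subset_Icc_self hr01) hqr
      rcases hq with (rfl | rfl) | h | h
      · exact lt_irrefl _ hr01.1
      · exact lt_irrefl _ hr01.2
      · exact absurd h.2 (not_le.2 hr.1)
      · exact absurd h.1 (not_le.2 hr.2)
  obtain ⟨w, hw, hcl⟩ := exists_component_arc_subset_closure hK hst
    ((D.curve_continuousOn e he).mono hsub) ((D.curve_injOn e he).mono hsub)
    (Or.inr (Or.inr ⟨s, Or.inr (Or.inl ⟨hs01.1, le_rfl⟩), rfl⟩))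
    (Or.inr (Or.inr ⟨t, Or.inr (Or.inr ⟨le_rfl, ht01.2⟩), rfl⟩)) hdisj
  rw [hcar] at hw hcl
  have hopen : IsOpen (connectedComponentIn D.carrierᶜ w) :=
    (isCompact_carrier hV hE).isClosed.isOpen_compl.connectedComponentIn
  have hfr : ∀ r ∈ Icc s t, D.curve e r ∈ frontier (connectedComponentIn D.carrierᶜ w) := by
    intro r hr
    rw [hopen.frontier_eq]
    exact ⟨hcl (mem_image_of_mem _ hr), fun h =>
      connectedComponentIn_subset _ _ h (curve_mem_carrier he (hsub hr))⟩
  exact D.faceDist_le_one ⟨w, hw, rfl⟩ (hfr s (left_mem_Icc.2 hst.le))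
    (hfr t (right_mem_Icc.2 hst.le))

/-- Along an edge, the face-distance is at most the number of vertices of the planarization that
are passed. -/
theorem faceDist_le_of_encard_le (hV : V(G).Finite) (hE : E(G).Finite) {e : β} (he : e ∈ E(G))
    {t : ℝ} (ht : t ∈ D.params e) (n : ℕ) {s : ℝ} (hs : s ∈ D.params e) (hst : s ≤ t)
    (hn : (D.params e ∩ Ioc s t).encard ≤ n) :
    D.faceDist (D.vertexAt e s hs) (D.vertexAt e t ht) ≤ n := by
  induction n generalizing s with
  | zero =>
    rcases hst.eq_or_lt with rfl | hlt
    · simp [faceDist_self]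
    · have h0 : D.params e ∩ Ioc s t = ∅ := by simpa using hn
      exact absurd (show t ∈ D.params e ∩ Ioc s t from ⟨ht, hlt, le_rfl⟩) (by simp [h0])
  | succ n ih =>
    rcases hst.eq_or_lt with rfl | hlt
    · simp [faceDist_self]
    · have hfin : (D.params e ∩ Ioc s t).Finite := finite_of_encard_le_coe hn
      -- `m` is the next vertex after `s`.
      obtain ⟨m, hm, hmin⟩ := exists_min_image _ id hfin ⟨t, ht, hlt, le_rfl⟩
      have hstep := faceDist_le_one_of_consecutive hV hE he hs hm.1 hm.2.1 fun r hr hrp =>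
        absurd (hmin r ⟨hrp, hr.1, hr.2.le.trans hm.2.2⟩) (not_le.2 hr.2)
      have hsub : insert m (D.params e ∩ Ioc m t) ⊆ D.params e ∩ Ioc s t :=
        insert_subset hm fun r hr => ⟨hr.1, hm.2.1.trans hr.2.1, hr.2.2⟩
      have hcard : (D.params e ∩ Ioc m t).encard ≤ n := by
        have h1 := (encard_le_encard hsub).trans hn
        rw [encard_insert_of_notMem (fun h => lt_irrefl _ h.2.1)] at h1
        push_cast at h1
        exact (ENat.add_le_add_iff_right ENat.one_ne_top).1 h1
      calc _ ≤ _ := D.faceDist_triangle _ (D.vertexAt e m hm.1) _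
        _ ≤ 1 + (n : ℕ∞) := add_le_add hstep (ih hm.1 hm.2.2 hcard)
        _ = _ := by push_cast; rw [add_comm]

/-! ### Distance bounds around a crossing. -/

/-- Every vertex on an edge is within face-distance `k` of every crossing on that edge. -/
theorem faceDist_le_of_crossing (hV : V(G).Finite) (hE : E(G).Finite) {k : ℕ}
    (hk : D.IsKPlane k) {c : D.PVertex} {e f : β} (hc : D.CrossAt e f c) {v : D.PVertex}
    (hv : v ∈ D.edgeVertices e) : D.faceDist c v ≤ k := by
  have he := hc.1
  obtain ⟨s, hs01, hs⟩ := hc.2.2.2.1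
  obtain ⟨t, ht01, ht⟩ := hv
  have hsp : s ∈ D.params e := ⟨Ioo_subset_Icc_self hs01, by rw [hs]; exact c.2⟩
  have htp : t ∈ D.params e := ⟨ht01, by rw [ht]; exact v.2⟩
  obtain rfl : D.vertexAt e s hsp = c := Subtype.ext hs
  obtain rfl : D.vertexAt e t htp = v := Subtype.ext ht
  have hcard := encard_params_inter_Ioo_le hk he
  rcases le_total t s with h | h
  · rw [faceDist_comm]
    refine faceDist_le_of_encard_le hV hE he hsp k htp h ((encard_le_encard ?_).trans hcard)
    exact fun r hr => ⟨hr.1, ht01.1.trans_lt hr.2.1, hr.2.2.trans_lt hs01.2⟩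
  · refine faceDist_le_of_encard_le hV hE he htp k hsp h ?_
    -- The end `1` may be counted, but the crossing at `s` is not, so the total stays at most `k`.
    have hsub : D.params e ∩ Ioc s t ⊆ insert 1 ((D.params e ∩ Ioo 0 1) \ {s}) := by
      rintro r ⟨hr, h1, h2⟩
      rcases (h2.trans ht01.2).eq_or_lt with rfl | h3
      · exact mem_insert _ _
      · exact mem_insert_of_mem _ ⟨⟨hr, hs01.1.trans h1, h3⟩, h1.ne'⟩
    calc _ ≤ _ := encard_le_encard hsub
      _ ≤ _ := encard_insert_le _ _
      _ = _ := encard_sdiff_singleton_add_one (show s ∈ D.params e ∩ Ioo 0 1 from ⟨hsp, hs01⟩)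
      _ ≤ _ := hcard

theorem point_mem_curve_image {e : β} {a : α} (h : G.Inc e a) :
    D.point a ∈ D.curve e '' Icc 0 1 := by
  obtain ⟨x, y, hl, h0, h1⟩ := D.curve_ends e h.edge_mem
  obtain ⟨b, hb⟩ := h
  rcases hb.eq_and_eq_or_eq_and_eq hl with ⟨rfl, rfl⟩ | ⟨rfl, rfl⟩
  · exact ⟨0, by simp, h0⟩
  · exact ⟨1, by simp, h1⟩

/-- An injective curve excludes loops; thus a one-edge walk is a path. -/
theorem ne_of_isLink (D : PlaneDrawing G) {g : β} {a b : α} (h : G.IsLink g a b) : a ≠ b := by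
  rintro rfl
  obtain ⟨x, y, hl, h0, h1⟩ := D.curve_ends g h.edge_mem
  have hxy : x = y := by
    rcases h.eq_and_eq_or_eq_and_eq hl with ⟨h2, h3⟩ | ⟨h2, h3⟩
    · exact h2.symm.trans h3
    · exact h3.symm.trans h2
  have := D.curve_injOn g h.edge_mem (by simp) (by simp) (h0.trans (hxy ▸ h1.symm))
  exact zero_ne_one this

theorem faceDist_le_of_joinsConsecutive (hV : V(G).Finite) (hE : E(G).Finite) {k : ℕ}
    (hk : D.IsKPlane k) {c : D.PVertex} {e f g : β} (hc : D.CrossAt e f c)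
    (hg : D.JoinsConsecutive e f g) {v : D.PVertex} (hv : v ∈ D.edgeVertices g) :
    D.faceDist c v ≤ ((3 * k + 1) / 2 : ℕ) := by
  obtain ⟨a, b, hea, hfb, hl⟩ := hg
  have hgE : g ∈ E(G) := hl.edge_mem
  obtain ⟨t, ht01, ht⟩ := hv
  have htp : t ∈ D.params g := ⟨ht01, by rw [ht]; exact v.2⟩
  obtain rfl : D.vertexAt g t htp = v := Subtype.ext ht
  have h0p := zero_mem_params (D := D) hgE
  have h1p := one_mem_params (D := D) hgE
  have hends : D.faceDist c (D.vertexAt g 0 h0p) ≤ k ∧ D.faceDist c (D.vertexAt g 1 h1p) ≤ k := by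
    have hA : ∀ w : D.PVertex, (w : ℂ) = D.point a → D.faceDist c w ≤ k := fun w hw =>
      faceDist_le_of_crossing hV hE hk hc
        (show (w : ℂ) ∈ _ by rw [hw]; exact point_mem_curve_image hea)
    have hB : ∀ w : D.PVertex, (w : ℂ) = D.point b → D.faceDist c w ≤ k := fun w hw =>
      faceDist_le_of_crossing hV hE hk hc.symm
        (show (w : ℂ) ∈ _ by rw [hw]; exact point_mem_curve_image hfb)
    obtain ⟨x, y, hl', h0, h1⟩ := D.curve_ends g hgE
    rcases hl.eq_and_eq_or_eq_and_eq hl' with ⟨rfl, rfl⟩ | ⟨rfl, rfl⟩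
    · exact ⟨hA _ h0, hB _ h1⟩
    · exact ⟨hB _ h0, hA _ h1⟩
  have hcard := encard_params_inter_Ioc_le hk hgE
  have hunion : (D.params g ∩ Ioc 0 t).encard + (D.params g ∩ Ioc t 1).encard ≤ k + 1 := by
    rw [← encard_union_eq, ← inter_union_distrib_left, Ioc_union_Ioc_eq_Ioc ht01.1 ht01.2]
    · exact hcard
    · exact disjoint_left.2 fun r h1 h2 => absurd h2.2.1 (not_lt.2 h1.2.2)
  have hfin := finite_of_encard_le_coe (k := k + 1) (by exact_mod_cast hcard)
  have hfin1 : (D.params g ∩ Ioc 0 t).Finite :=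
    hfin.subset (inter_subset_inter_right _ (Ioc_subset_Ioc_right ht01.2))
  have hfin2 : (D.params g ∩ Ioc t 1).Finite :=
    hfin.subset (inter_subset_inter_right _ (Ioc_subset_Ioc_left ht01.1))
  rw [← hfin1.cast_ncard_eq, ← hfin2.cast_ncard_eq] at hunion
  set n₁ := (D.params g ∩ Ioc 0 t).ncard
  set n₂ := (D.params g ∩ Ioc t 1).ncard
  have hsum : n₁ + n₂ ≤ k + 1 := by exact_mod_cast hunion
  have hd1 := faceDist_le_of_encard_le hV hE hgE htp n₁ h0p ht01.1 hfin1.cast_ncard_eq.symm.le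
  have hd2 := faceDist_le_of_encard_le hV hE hgE h1p n₂ htp ht01.2 hfin2.cast_ncard_eq.symm.le
  rw [faceDist_comm] at hd2
  -- Approach from the nearer end: the smaller count is at most `(k + 1) / 2`.
  rcases le_total n₁ n₂ with h | h
  · calc _ ≤ _ := D.faceDist_triangle _ _ _
      _ ≤ (k : ℕ∞) + n₁ := add_le_add hends.1 hd1
      _ ≤ _ := by norm_cast; omega
  · calc _ ≤ _ := D.faceDist_triangle _ _ _
      _ ≤ (k : ℕ∞) + n₂ := add_le_add hends.2 hd2
      _ ≤ _ := by norm_cast; omega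

theorem edgeVertices_union_subset_ball (hV : V(G).Finite) (hE : E(G).Finite) {k : ℕ}
    (hk : D.IsKPlane k) {c : D.PVertex} {e f g : β} (hc : D.CrossAt e f c)
    (hg : D.JoinsConsecutive e f g) :
    D.edgeVertices e ∪ D.edgeVertices g ∪ D.edgeVertices f ⊆ D.ball c ((3 * k + 1) / 2) := by
  have hkk : (k : ℕ∞) ≤ ((3 * k + 1) / 2 : ℕ) := by norm_cast; omega
  rintro v ((hv | hv) | hv)
  · exact (faceDist_le_of_crossing hV hE hk hc hv).trans hkk
  · exact faceDist_le_of_joinsConsecutive hV hE hk hc hg hv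
  · exact (faceDist_le_of_crossing hV hE hk hc.symm hv).trans hkk

end PlaneDrawing

theorem mainTheorem4 {α β : Type*} (G : Graph α β) (hV : V(G).Finite) (hE : E(G).Finite)
    (D : PlaneDrawing G) (k : ℕ) (hk : D.IsKPlane k)
    (c : D.PVertex) (hc : D.IsCrossing c) (hx : ¬ D.IsXCrossing c) :
    D.ribbonRadius c ≤ (((3 * k + 1) / 2 : ℕ) : ℕ∞) ∧
      ∀ e f g : β, D.CrossAt e f c → g ≠ e → g ≠ f → D.JoinsConsecutive e f g →
        D.edgeVertices e ∪ D.edgeVertices g ∪ D.edgeVertices f ⊆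
          D.ball c ((3 * k + 1) / 2) := by
  refine ⟨?_, fun e f g hef _ _ hg =>
    PlaneDrawing.edgeVertices_union_subset_ball hV hE hk hef hg⟩
  obtain ⟨e, f, hef, g, hg, -⟩ : ∃ e f, D.CrossAt e f c ∧ ∃ g, D.JoinsConsecutive e f g ∧
      ¬ (g = e ∨ g = f) := by
    by_contra hcon
    exact hx ⟨hc, fun e f hef g hg => by_contra fun h => hcon ⟨e, f, hef, g, hg, h⟩⟩
  have hsub := PlaneDrawing.edgeVertices_union_subset_ball hV hE hk hef hg
  refine iInf₂_le _ ⟨e, f, hef, fun v hv => hsub (Or.inl (Or.inl hv)),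
    fun v hv => hsub (Or.inr hv), ?_⟩
  obtain ⟨a, b, hea, hfb, hl⟩ := hg
  refine ⟨a, b, hea, hfb, .cons g hl (.nil hl.right_mem), ?_, ?_⟩
  · simp [GraphWalk.IsPath, GraphWalk.support, D.ne_of_isLink hl]
  · intro g' hg' v hv
    obtain rfl : g' = g := by simpa [GraphWalk.edges] using hg'
    exact hsub (Or.inl (Or.inr hv))
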